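/- Let $p$ be a prime, $k$ an algebraically closed field of characteristic $p$, $G$ a finite group and $P$ a normal $p$-subgroup of $G$ such that $p$ does not divide $|G/P\,C_G(P)|$. Let $M=\mathrm{Sc}(G,P)$ be the Scott $kG$-module with respect to $P$, i.e. the (up to isomorphism unique) indecomposable direct summand of $\mathrm{Ind}_P^G k_P$ which contains the trivial module $k_G$ in its top $M/\mathrm{rad}\,M$. Then $M$ is Brauer indecomposable: for every subgroup $Q\le P$, the restriction to $Q\,C_G(Q)$ of the $kN_G(Q)$-module $$M(Q)=M^Q\Big/\sum_{R<Q}\mathrm{tr}_R^Q(M^R)$$ is indecomposable or zero. Here, for a subgroup $R<Q$, $M^R$ denotes the space of $R$-fixed points of $M$, and $\mathrm{tr}_R^Q(m)=\sum_{h\in[Q/R]}hm$ for $m\in M^R$, where $[Q/R]$ is a set of representatives of the left cosets of $R$ in $Q$. -/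

import Mathlib

noncomputable section

namespace ScottBrauer

open scoped MonoidAlgebra

variable {k G V : Type*} [Field k] [Group G] [AddCommGroup V] [Module k V]

/-- Restriction `Res^G_H M` of a representation to a subgroup. -/
abbrev res (ρ : Representation k G V) (H : Subgroup G) : Representation k H V :=
  ρ.comp H.subtype

/-- A representation (a `kG`-module) is indecomposable if it is nonzero and is not the direct sum
of two nonzero submodules. -/
def IsIndecomposable (ρ : Representation k G V) : Prop :=
  Nontrivial V ∧ ∀ W₁ W₂ : Subrepresentation ρ, IsCompl W₁ W₂ → W₁ = ⊥ ∨ W₂ = ⊥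

/-- `L ∣ M`: the representation `ρ` is isomorphic to a direct summand of `σ`. -/
def IsDirectSummand {W : Type*} [AddCommGroup W] [Module k W]
    (ρ : Representation k G V) (σ : Representation k G W) : Prop :=
  ∃ W₁ W₂ : Subrepresentation σ, IsCompl W₁ W₂ ∧ Nonempty (ρ.Equiv W₁.toRepresentation)

/-- The trivial module `k_G` is contained in the top `M / rad M` of `M`, where `rad M` is the
intersection of the maximal submodules of `M`. -/
def TrivialInTop (ρ : Representation k G V) : Prop :=
  ∃ f : (Representation.trivial k G k).asModule →ₗ[k[G]]
      (ρ.asModule ⧸ Module.jacobson k[G] ρ.asModule), Function.Injective f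

/-- `ρ` is (a model of) the Scott module `Sc(G,H)`: an indecomposable direct summand of
`Ind_H^G k_H` which has the trivial module `k_G` in its top. -/
structure IsScottModule (ρ : Representation k G V) (H : Subgroup G) : Prop where
  isIndecomposable : IsIndecomposable ρ
  isDirectSummand :
    IsDirectSummand ρ (Representation.ind H.subtype (Representation.trivial k H k))
  trivialInTop : TrivialInTop ρ

/-- The fixed points `M^K` of a subgroup `K`. -/
abbrev fixed (ρ : Representation k G V) (K : Subgroup G) : Submodule k V :=
  (res ρ K).invariants

/-- On `M^K`, the action of an element `x` of `H` depends only on its coset `xK`. -/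
lemma out_apply (ρ : Representation k G V) (K H : Subgroup G) {m : V} (hm : m ∈ fixed ρ K)
    (x : H) : ρ (((x : H ⧸ K.subgroupOf H).out : H) : G) m = ρ (x : G) m := by
  obtain ⟨h, hh⟩ := QuotientGroup.mk_out_eq_mul (K.subgroupOf H) x
  have h1 : ρ ((h : H) : G) m = m := hm ⟨((h : H) : G), h.2⟩
  rw [hh, Subgroup.coe_mul, map_mul, Module.End.mul_apply, h1]

/-- The relative trace map `tr_K^H : M^K → M^H`, `m ↦ ∑_{h ∈ [H/K]} h m`, the sum being over
representatives of the left cosets of `K` in `H` (it is used for `K ≤ H`). -/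
def relTrace [Finite G] (ρ : Representation k G V) (K H : Subgroup G) :
    fixed ρ K →ₗ[k] fixed ρ H where
  toFun m := ⟨∑ᶠ h : H ⧸ K.subgroupOf H, ρ ((h.out : H) : G) (m : V), fun x => by
    change ρ (x : G) _ = _
    rw [map_finsum _ (Set.toFinite _)]
    conv_rhs => rw [← finsum_comp_equiv (MulAction.toPerm x : Equiv.Perm (H ⧸ K.subgroupOf H))]
    refine finsum_congr fun q => ?_
    have hq : x • q = ((x * q.out : H) : H ⧸ K.subgroupOf H) := by
      conv_lhs => rw [← q.out_eq]
      rfl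
    rw [MulAction.toPerm_apply, hq, out_apply ρ K H m.2]
    simp⟩
  map_add' a b := by
    ext
    simp only [Submodule.coe_add, map_add]
    exact finsum_add_distrib (Set.toFinite _) (Set.toFinite _)
  map_smul' c a := by
    ext
    simp only [Submodule.coe_smul, map_smul, RingHom.id_apply]
    exact (smul_finsum c _).symm

/-- The submodule `∑_{K < Q} tr_K^Q (M^K)` of `M^Q`. -/
def traceSum [Finite G] (ρ : Representation k G V) (Q : Subgroup G) :
    Submodule k (fixed ρ Q) :=
  ⨆ (K : Subgroup G) (_ : K < Q), LinearMap.range (relTrace ρ K Q)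

lemma fixed_stable (ρ : Representation k G V) (Q : Subgroup G)
    (n : Subgroup.normalizer (Q : Set G)) : fixed ρ Q ≤ (fixed ρ Q).comap (res ρ _ n) := by
  intro m hm x
  have h1 : (n : G)⁻¹ * x * n ∈ Q := by
    have := (Subgroup.mem_normalizer_iff.1 (inv_mem n.2) (x : G)).1 x.2
    simpa using this
  have h2 : ρ ((n : G)⁻¹ * x * n) m = m := hm ⟨_, h1⟩
  change ρ (x : G) (ρ (n : G) m) = ρ (n : G) m
  conv_rhs => rw [← h2]
  rw [← Module.End.mul_apply, ← Module.End.mul_apply, ← map_mul, ← map_mul]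
  congr 2
  group

/-- `M^Q` as a representation of `N_G(Q)`. -/
def fixedRep (ρ : Representation k G V) (Q : Subgroup G) :
    Representation k (Subgroup.normalizer (Q : Set G)) (fixed ρ Q) :=
  (res ρ (Subgroup.normalizer (Q : Set G))).subrepresentation (fixed ρ Q) (fixed_stable ρ Q)

lemma traceSum_stable [Finite G] (ρ : Representation k G V) (Q : Subgroup G)
    (n : Subgroup.normalizer (Q : Set G)) :
    traceSum ρ Q ≤ (traceSum ρ Q).comap (fixedRep ρ Q n) := by
  refine iSup₂_le fun K hK => ?_
  rintro _ ⟨m, rfl⟩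
  have hn : ∀ h : G, h ∈ Q ↔ (n : G) * h * (n : G)⁻¹ ∈ Q := Subgroup.mem_normalizer_iff.1 n.2
  let K' : Subgroup G := K.map (MulAut.conj (n : G)).toMonoidHom
  have hmem : ∀ y : G, (n : G) * y * (n : G)⁻¹ ∈ K' ↔ y ∈ K := fun y =>
    Subgroup.mem_map_iff_mem (f := (MulAut.conj (n : G)).toMonoidHom) (MulAut.conj (n : G)).injective
  have hsurj : ∀ y : G, y = (n : G) * ((n : G)⁻¹ * y * n) * (n : G)⁻¹ := fun y => by group
  have hK' : K' < Q := by
    refine lt_of_le_not_ge ?_ fun hle => hK.not_ge fun y hy => ?_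
    · rintro _ ⟨y, hy, rfl⟩
      exact (hn y).1 (hK.le hy)
    · exact (hmem y).1 (hle ((hn y).1 hy))
  have hm' : ρ (n : G) (m : V) ∈ fixed ρ K' := by
    rintro ⟨x, y, hy, rfl⟩
    have h2 : ρ y (m : V) = m := m.2 ⟨y, hy⟩
    change ρ ((n : G) * y * (n : G)⁻¹) (ρ (n : G) (m : V)) = ρ (n : G) (m : V)
    conv_rhs => rw [← h2]
    rw [← Module.End.mul_apply, ← Module.End.mul_apply, ← map_mul, ← map_mul]
    congr 2
    group
  let e : Q ≃ Q :=
    { toFun := fun x => ⟨(n : G) * x * (n : G)⁻¹, (hn x).1 x.2⟩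
      invFun := fun x => ⟨(n : G)⁻¹ * x * n, (hn _).2 (by rw [← hsurj]; exact x.2)⟩
      left_inv := fun x => by ext; simp [mul_assoc]
      right_inv := fun x => by ext; simp [mul_assoc] }
  let E : (Q ⧸ K.subgroupOf Q) ≃ (Q ⧸ K'.subgroupOf Q) := Quotient.congr e fun a b => by
    change QuotientGroup.leftRel _ a b ↔ QuotientGroup.leftRel _ (e a) (e b)
    rw [QuotientGroup.leftRel_apply, QuotientGroup.leftRel_apply, Subgroup.mem_subgroupOf,
      Subgroup.mem_subgroupOf, ← hmem]
    have : (n : G) * ((a⁻¹ * b : Q) : G) * (n : G)⁻¹ = (((e a)⁻¹ * e b : Q) : G) := by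
      simp [e, mul_assoc]
    rw [this]
  have key : fixedRep ρ Q n (relTrace ρ K Q m) = relTrace ρ K' Q ⟨_, hm'⟩ := by
    ext
    change ρ (n : G) (∑ᶠ h : Q ⧸ K.subgroupOf Q, ρ ((h.out : Q) : G) (m : V)) =
      ∑ᶠ h : Q ⧸ K'.subgroupOf Q, ρ ((h.out : Q) : G) (ρ (n : G) (m : V))
    rw [map_finsum _ (Set.toFinite _), ← finsum_comp_equiv E]
    refine finsum_congr fun q => ?_
    have hq : E q = ((e q.out : Q) : Q ⧸ K'.subgroupOf Q) := by
      conv_lhs => rw [← q.out_eq]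
      rfl
    rw [hq, out_apply ρ K' Q hm', ← Module.End.mul_apply, ← Module.End.mul_apply, ← map_mul,
      ← map_mul]
    congr 2
    simp [e]
  rw [Submodule.mem_comap, key]
  exact Submodule.mem_iSup_of_mem K' (Submodule.mem_iSup_of_mem hK' ⟨_, rfl⟩)

/-- The Brauer construction `M(Q) = M^Q / ∑_{K < Q} tr_K^Q (M^K)` as a representation of
`N_G(Q)`. -/
def brauer [Finite G] (ρ : Representation k G V) (Q : Subgroup G) :
    Representation k (Subgroup.normalizer (Q : Set G)) (fixed ρ Q ⧸ traceSum ρ Q) :=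
  (fixedRep ρ Q).quotient (traceSum ρ Q) (traceSum_stable ρ Q)

/-- `Q C_G(Q)` is contained in `N_G(Q)`. -/
lemma mul_centralizer_le_normalizer (Q : Subgroup G) :
    Q ⊔ Subgroup.centralizer (Q : Set G) ≤ Subgroup.normalizer (Q : Set G) := by
  refine sup_le Subgroup.le_normalizer fun g hg => Subgroup.mem_normalizer_iff.2 fun h => ?_
  rw [Subgroup.mem_centralizer_iff] at hg
  constructor
  · intro hh
    rw [← hg h hh, mul_inv_cancel_right]
    exact hh
  · intro hh
    have h1 := hg _ hh
    have h2 : h = g * h * g⁻¹ := by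
      have h3 : g * h = g * (g * h * g⁻¹) := by rw [← h1]; group
      exact mul_left_cancel h3
    rw [h2]
    exact hh

/-- `M` is Brauer indecomposable with respect to `P`: for every subgroup `Q` of `P`, the
restriction of `M(Q)` to `Q C_G(Q)` is indecomposable or zero. -/
def IsBrauerIndecomposable [Finite G] (ρ : Representation k G V) (P : Subgroup G) : Prop :=
  ∀ Q : Subgroup G, Q ≤ P →
    IsIndecomposable
        ((brauer ρ Q).comp (Subgroup.inclusion (mul_centralizer_le_normalizer Q))) ∨
      Subsingleton (fixed ρ Q ⧸ traceSum ρ Q)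

end ScottBrauer

end

/-
Since `P` is normal, it acts trivially on `Ind_P^G k_P`, hence on `M`. Let `π : M → k` be a nonzero
equivariant map and `N` a submodule not contained in `ker π`. By Frobenius reciprocity the map
`Ind_P^G k_P → M → k` lifts to `N`, which gives an endomorphism `f` of `M` with image in `N` and
`π ∘ f = π`. It is not nilpotent, so it is bijective by Fitting's lemma, and `N = M`. Thus `ker π`
is the greatest proper submodule of `M`, and hence contained in the radical of `M`.

Let `H = P C_G(P)`, a normal subgroup of index prime to `p`. By the relative Maschke theorem the
radical of `M` is contained in the radical of its restriction to `H`, so the hyperplane `ker π` is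
also the greatest proper `kH`-submodule, and `M` is indecomposable over `H`. For `Q ≤ P` the
relative traces to `Q` vanish, so `M(Q)` is `M`, and each element of `H` acts on it as an element
of `C_G(P) ≤ Q C_G(Q)`.
-/

noncomputable section

namespace ScottBrauer

open Representation
open scoped MonoidAlgebra

section Induction

variable {k G H A B : Type*} [CommRing k] [Group G] [Group H] [AddCommGroup A] [Module k A]
  [AddCommGroup B] [Module k B] {φ : G →* H} {ρ : Representation k G A} {σ : Representation k H B}

lemma indV_mk_map_mul (x : G) (h : H) (a : A) :
    IndV.mk φ ρ (φ x * h) (ρ x a) = IndV.mk φ ρ h a := by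
  have := Coinvariants.mk_self_apply (tprod ((leftRegular k H).comp φ) ρ) x
    (TensorProduct.tmul k (MonoidAlgebra.single h 1) a)
  simpa using this

/-- Frobenius reciprocity: the `H`-equivariant map `Ind_φ A → B` that extends a `G`-equivariant map
`f : A → Res_φ B`. -/
def indLift (f : ρ.IntertwiningMap (σ.comp φ)) : (ind φ ρ).IntertwiningMap σ where
  toLinearMap := Coinvariants.lift _
    (TensorProduct.lift <| (Finsupp.lift _ _ _ fun h => σ h⁻¹ ∘ₗ f.toLinearMap) ∘ₗ
      (MonoidAlgebra.coeffLinearEquiv k).toLinearMap)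
    fun g => by
      ext h a
      simp [f.isIntertwining]
  isIntertwining' h := by ext; simp

lemma indLift_mk_one (f : ρ.IntertwiningMap (σ.comp φ)) (a : A) :
    indLift f (IndV.mk φ ρ 1 a) = f a := by
  rw [← IntertwiningMap.toLinearMap_apply]
  simp [indLift]

lemma ind_hom_ext {f g : (ind φ ρ).IntertwiningMap σ}
    (hfg : ∀ a, f (IndV.mk φ ρ 1 a) = g (IndV.mk φ ρ 1 a)) : f = g := by
  refine IntertwiningMap.ext <| IndV.hom_ext _ _ fun h => LinearMap.ext fun a => ?_
  have hmk : IndV.mk φ ρ h a = ind φ ρ h⁻¹ (IndV.mk φ ρ 1 a) := by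
    rw [ind_mk, inv_inv, one_mul]
  change f (IndV.mk φ ρ h a) = g (IndV.mk φ ρ h a)
  rw [hmk, f.isIntertwining, g.isIntertwining, hfg]

lemma ind_trivial_apply_of_mem {P : Subgroup G} [P.Normal] {x : G} (hx : x ∈ P) :
    ind P.subtype (trivial k P A) x = 1 := by
  refine IndV.hom_ext _ _ fun g => LinearMap.ext fun a => ?_
  have hconj : g * x⁻¹ * g⁻¹ ∈ P := Subgroup.Normal.conj_mem ‹_› _ (inv_mem hx) g
  have := indV_mk_map_mul (φ := P.subtype) (ρ := trivial k P A) ⟨_, hconj⟩ g a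
  rw [LinearMap.comp_apply, ind_mk, ← inv_mul_cancel_right (g * x⁻¹) g]
  exact this

instance [Finite H] [Module.Finite k A] : Module.Finite k (IndV φ ρ) :=
  have : Module.Finite k k[H] :=
    Module.Finite.equiv (MonoidAlgebra.coeffLinearEquiv k (M := H) (S := k)).symm
  Module.Finite.of_surjective _ (Submodule.mkQ_surjective _)

end Induction

variable {k G V W : Type*} [Field k] [Group G] [AddCommGroup V] [Module k V] [AddCommGroup W]
  [Module k W] {ρ : Representation k G V} {σ : Representation k G W}

lemma isCompl_toSubmodule {N₁ N₂ : Subrepresentation ρ} :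
    IsCompl N₁.toSubmodule N₂.toSubmodule ↔ IsCompl N₁ N₂ := by
  simp only [isCompl_iff, disjoint_iff, codisjoint_iff, ← Subrepresentation.toSubmodule_inf,
    ← Subrepresentation.toSubmodule_sup]
  exact and_congr (Subrepresentation.toSubmodule_injective.eq_iff (b := ⊥))
    (Subrepresentation.toSubmodule_injective.eq_iff (b := ⊤))

/-- The projection of a representation onto the first of two complementary subrepresentations. -/
def projection {N₁ N₂ : Subrepresentation ρ} (h : IsCompl N₁ N₂) :
    ρ.IntertwiningMap N₁.toRepresentation where
  toLinearMap := Submodule.projectionOnto _ _ (isCompl_toSubmodule.2 h)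
  isIntertwining' g := by
    have hc := isCompl_toSubmodule.2 h
    refine LinearMap.ext fun v => ?_
    obtain ⟨a, b, ha, hb, rfl⟩ := Submodule.codisjoint_iff_exists_add_eq.1 hc.codisjoint v
    lift a to N₁.toSubmodule using ha
    lift b to N₂.toSubmodule using hb
    have ha : Submodule.projectionOnto _ _ hc (ρ g a) = N₁.toRepresentation g a :=
      Submodule.projectionOnto_apply_left hc (N₁.toRepresentation g a)
    have hb : Submodule.projectionOnto _ _ hc (ρ g b) = 0 :=
      Submodule.projectionOnto_apply_right hc (N₂.toRepresentation g b)
    simp [ha, hb]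

lemma projection_apply_coe {N₁ N₂ : Subrepresentation ρ} (h : IsCompl N₁ N₂)
    (v : N₁.toSubmodule) : projection h v = v :=
  Submodule.projectionOnto_apply_left (isCompl_toSubmodule.2 h) v

/-- The inclusion of a subrepresentation as an intertwining map. -/
def inclusion (N : Subrepresentation ρ) : N.toRepresentation.IntertwiningMap ρ :=
  ⟨N.toSubmodule.subtype, fun _ => rfl⟩

lemma IsDirectSummand.exists_retract (h : IsDirectSummand ρ σ) :
    ∃ (i : ρ.IntertwiningMap σ) (r : σ.IntertwiningMap ρ), ∀ v, r (i v) = v := by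
  obtain ⟨N₁, N₂, hN, ⟨e⟩⟩ := h
  refine ⟨(inclusion N₁).comp e.toIntertwiningMap, e.symm.toIntertwiningMap.comp (projection hN),
    fun v => ?_⟩
  have hproj : projection hN (e v : N₁.toSubmodule) = e v := projection_apply_coe hN (e v)
  exact (congrArg e.symm hproj).trans (e.symm_apply_apply v)

lemma IsDirectSummand.finiteDimensional [FiniteDimensional k W] (h : IsDirectSummand ρ σ) :
    FiniteDimensional k V := by
  obtain ⟨i, r, hr⟩ := h.exists_retract
  exact Module.Finite.of_surjective r.toLinearMap fun v => ⟨i v, hr v⟩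

lemma IsDirectSummand.apply_eq_self {P : Subgroup G} [P.Normal]
    (h : IsDirectSummand ρ (ind P.subtype (trivial k P k))) {x : G} (hx : x ∈ P) (v : V) :
    ρ x v = v := by
  obtain ⟨i, r, hr⟩ := h.exists_retract
  have hix : i (ρ x v) = i v := by
    rw [i.isIntertwining, ind_trivial_apply_of_mem hx, Module.End.one_apply]
  rw [← hr (ρ x v), hix, hr]

lemma IsIndecomposable.bijective_or_isNilpotent [FiniteDimensional k V]
    (h : IsIndecomposable ρ) (f : ρ.IntertwiningMap ρ) : Function.Bijective f ∨ IsNilpotent f := by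
  have hpow (n : ℕ) : (f ^ n).toLinearMap = f.toLinearMap ^ n := by
    induction n with
    | zero => rfl
    | succ n ih => rw [pow_succ, pow_succ, ← ih]; rfl
  obtain ⟨n, hcompl, hn⟩ := ((LinearMap.eventually_isCompl_ker_pow_range_pow f.toLinearMap).and
    (Filter.eventually_ne_atTop 0)).exists
  have hfitting : IsCompl (f ^ n).ker (f ^ n).range := by
    rw [← isCompl_toSubmodule, IntertwiningMap.ker_toSubmodule, IntertwiningMap.range_toSubmodule,
      hpow]
    exact hcompl
  rcases h.2 _ _ hfitting with hker | hrange
  · left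
    have hker' : LinearMap.ker (f.toLinearMap ^ n) = ⊥ := by
      rw [← hpow]
      exact congrArg Subrepresentation.toSubmodule hker
    have hinj : Function.Injective f.toLinearMap :=
      Module.End.injective_of_iterate_injective hn (LinearMap.ker_eq_bot.1 hker')
    exact ⟨hinj, LinearMap.injective_iff_surjective.1 hinj⟩
  · right
    refine ⟨n, IntertwiningMap.ext (LinearMap.range_eq_bot.1 ?_)⟩
    exact congrArg Subrepresentation.toSubmodule hrange

lemma not_isNilpotent_of_comp_eq {π : ρ.IntertwiningMap σ} (hπ : π ≠ 0)
    {f : ρ.IntertwiningMap ρ} (hf : π.comp f = π) : ¬ IsNilpotent f := by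
  rintro ⟨n, hn⟩
  have hpow : π.comp (f ^ n) = π := by
    clear hn
    induction n with
    | zero => rfl
    | succ n ih =>
      calc π.comp (f ^ (n + 1)) = (π.comp f).comp (f ^ n) := by rw [pow_succ']; rfl
        _ = π := by rw [hf, ih]
  refine hπ ?_
  rw [← hpow, hn]
  exact IntertwiningMap.ext (LinearMap.ext fun _ => map_zero π)

lemma isCoatom_of_isCoatom_toSubmodule {N : Subrepresentation ρ} (hN : IsCoatom N.toSubmodule) :
    IsCoatom N :=
  ⟨fun h => hN.1 (congrArg Subrepresentation.toSubmodule h), fun _ hlt =>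
    Subrepresentation.toSubmodule_injective (hN.2 _ hlt)⟩

lemma isCoatom_ker_toSubmodule {π : ρ.IntertwiningMap (trivial k G k)} (hπ : π ≠ 0) :
    IsCoatom π.ker.toSubmodule :=
  LinearMap.isCoatom_ker_of_surjective <| LinearMap.surjective fun h =>
    hπ (IntertwiningMap.ext h)

lemma IsIndecomposable.eq_top_of_apply_ne_zero [Finite G] (h : IsIndecomposable ρ)
    {P : Subgroup G} [P.Normal]
    (hρ : IsDirectSummand ρ (ind P.subtype (trivial k P k)))
    {π : ρ.IntertwiningMap (trivial k G k)} {N : Subrepresentation ρ} {n : V} (hn : n ∈ N)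
    (hπn : π n ≠ 0) : N = ⊤ := by
  have := hρ.finiteDimensional
  obtain ⟨i, r, hr⟩ := hρ.exists_retract
  -- The scalar `c` makes `π ∘ F` agree with `π ∘ r` on the generator of `Ind_P^G k_P`.
  let c : k := π (r (IndV.mk _ _ 1 1)) / π n
  let m : N.toSubmodule := c • ⟨n, hn⟩
  let f : (trivial k P k).IntertwiningMap (N.toRepresentation.comp P.subtype) :=
    ⟨LinearMap.toSpanSingleton k _ m, fun x => LinearMap.ext_ring <| by
      have hxm : N.toRepresentation x m = m := Subtype.ext (hρ.apply_eq_self x.2 _)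
      simp [hxm]⟩
  let F : (ind P.subtype (trivial k P k)).IntertwiningMap ρ := (inclusion N).comp (indLift f)
  have hF : π.comp F = π.comp r := by
    refine ind_hom_ext fun a => ?_
    have hFa : F (IndV.mk _ _ 1 a) = a • c • n := congrArg Subtype.val (indLift_mk_one f a)
    have hra : r (IndV.mk _ _ 1 a) = a • r (IndV.mk _ _ 1 1) := by
      rw [← map_smul, ← map_smul, smul_eq_mul, mul_one]
    calc π (F (IndV.mk _ _ 1 a)) = a • c • π n := by rw [hFa, map_smul, map_smul]
      _ = a • π (r (IndV.mk _ _ 1 1)) := congrArg (a • ·) (div_mul_cancel₀ _ hπn)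
      _ = π (r (IndV.mk _ _ 1 a)) := by rw [hra, map_smul]
  have hFi : π.comp (F.comp i) = π := by
    calc π.comp (F.comp i) = (π.comp r).comp i := by rw [← hF]; rfl
      _ = π := IntertwiningMap.ext (LinearMap.ext fun v => congrArg π (hr v))
  have hπ : π ≠ 0 := fun h0 => hπn (by rw [h0]; rfl)
  have hbij : Function.Bijective (F.comp i) :=
    (h.bijective_or_isNilpotent _).resolve_right (not_isNilpotent_of_comp_eq hπ hFi)
  refine top_le_iff.1 fun v _ => ?_
  obtain ⟨w, rfl⟩ := hbij.surjective v
  exact (indLift f (i w)).2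

lemma IsIndecomposable.isGreatest_ker [Finite G] (h : IsIndecomposable ρ) {P : Subgroup G}
    [P.Normal] (hρ : IsDirectSummand ρ (ind P.subtype (trivial k P k)))
    {π : ρ.IntertwiningMap (trivial k G k)} (hπ : π ≠ 0) :
    IsGreatest {N : Subrepresentation ρ | N ≠ ⊤} π.ker :=
  ⟨(isCoatom_of_isCoatom_toSubmodule (isCoatom_ker_toSubmodule hπ)).1, fun _ hN _ hn =>
    by_contra fun hπn => hN (h.eq_top_of_apply_ne_zero hρ hn hπn)⟩

lemma isIndecomposable_of_isGreatest {K : Subrepresentation ρ}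
    (hK : IsGreatest {N : Subrepresentation ρ | N ≠ ⊤} K) : IsIndecomposable ρ := by
  constructor
  · by_contra hV
    rw [not_nontrivial_iff_subsingleton] at hV
    exact hK.1 (Subrepresentation.toSubmodule_injective (Subsingleton.elim _ _))
  · intro N₁ N₂ hN
    have htop : N₁ = ⊤ ∨ N₂ = ⊤ := by
      by_contra! hne
      exact hK.1 (top_le_iff.1 (hN.sup_eq_top ▸ sup_le (hK.2 hne.1) (hK.2 hne.2)))
    rcases htop with rfl | rfl
    · exact .inr (top_disjoint.1 hN.disjoint)
    · exact .inl (disjoint_top.1 hN.disjoint)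

lemma TrivialInTop.exists_intertwiningMap [FiniteDimensional k V] (h : TrivialInTop ρ) :
    ∃ π : ρ.IntertwiningMap (trivial k G k), π ≠ 0 := by
  obtain ⟨f, hf⟩ := h
  have : IsArtinian k[G] ρ.asModule := isArtinian_of_tower k inferInstance
  have : IsSemisimpleModule k[G] (ρ.asModule ⧸ Module.jacobson k[G] ρ.asModule) :=
    (IsArtinian.isSemisimpleModule_iff_jacobson _ _).2 (Module.jacobson_quotient_jacobson _ _)
  obtain ⟨r, hr⟩ := IsSemisimpleModule.extension_property f hf LinearMap.id
  let π := r ∘ₗ (Module.jacobson k[G] ρ.asModule).mkQ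
  have hr_surj : Function.Surjective r := fun c => ⟨f c, LinearMap.congr_fun hr c⟩
  have hπ : Function.Surjective π := hr_surj.comp (Submodule.mkQ_surjective _)
  refine ⟨(IntertwiningMap.equivLinearMapAsModule ρ _).symm π, ?_⟩
  rw [ne_eq, LinearEquiv.map_eq_zero_iff]
  intro h0
  obtain ⟨v, hv⟩ := hπ (show k from 1)
  exact one_ne_zero (α := k) (hv.symm.trans (LinearMap.congr_fun h0 v))

/-- The radical of a representation: the intersection of its maximal subrepresentations. -/
def radical (ρ : Representation k G V) : Subrepresentation ρ :=
  Subrepresentation.subrepresentationSubmoduleOrderIso.symm (Module.jacobson k[G] ρ.asModule)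

lemma mem_radical {v : V} :
    v ∈ radical ρ ↔ ∀ N : Subrepresentation ρ, IsCoatom N → v ∈ N := by
  let e := Subrepresentation.subrepresentationSubmoduleOrderIso (ρ := ρ)
  exact (Submodule.mem_sInf (M := ρ.asModule)).trans
    ⟨fun h N hN => h (e N) ((e.isCoatom_iff _).2 hN),
      fun h N hN => h (e.symm N) ((e.symm.isCoatom_iff _).2 hN)⟩

lemma radical_le {N : Subrepresentation ρ} (hN : IsCoatom N) : radical ρ ≤ N :=
  fun _ hv => mem_radical.1 hv N hN

lemma isGreatest_of_isCoatom_of_le_radical [FiniteDimensional k V] {K : Subrepresentation ρ}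
    (hK : IsCoatom K) (hrad : K ≤ radical ρ) :
    IsGreatest {N : Subrepresentation ρ | N ≠ ⊤} K := by
  have : IsNoetherian k[G] ρ.asModule := isNoetherian_of_tower k inferInstance
  have : IsCoatomic (Subrepresentation ρ) :=
    Subrepresentation.subrepresentationSubmoduleOrderIso.isCoatomic_iff.2 inferInstance
  refine ⟨hK.1, fun N hN => ?_⟩
  obtain ⟨N', hN', hle⟩ := (eq_top_or_exists_le_coatom N).resolve_left hN
  exact hle.trans (((hK.le_iff_eq hN'.1).1 (hrad.trans (radical_le hN'))).le)

lemma le_radical_of_isGreatest {K : Subrepresentation ρ}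
    (hK : IsGreatest {N : Subrepresentation ρ | N ≠ ⊤} K) : K ≤ radical ρ := fun _ hv =>
  mem_radical.2 fun _ hN => (hN.le_iff_eq hK.1).1 (hK.2 hN.1) ▸ hv

lemma apply_mem_radical (f : ρ.IntertwiningMap σ) {v : V} (hv : v ∈ radical ρ) :
    f v ∈ radical σ :=
  Module.le_comap_jacobson (IntertwiningMap.equivLinearMapAsModule ρ σ f) hv

lemma radical_eq_bot [IsSemisimpleRepresentation ρ] : radical ρ = ⊥ := by
  have := (isSemisimpleRepresentation_iff_isSemisimpleModule_asModule ρ).1 ‹_›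
  rw [radical, IsSemisimpleModule.jacobson_eq_bot, OrderIso.map_bot]

lemma isSemisimpleRepresentation_of_ker_eq_radical [FiniteDimensional k V]
    (f : ρ.IntertwiningMap σ) (hf : Function.Surjective f) (hker : f.ker = radical ρ) :
    IsSemisimpleRepresentation σ := by
  have : FiniteDimensional k W := Module.Finite.of_surjective f.toLinearMap hf
  have : IsArtinian k[G] σ.asModule := isArtinian_of_tower k inferInstance
  let F := IntertwiningMap.equivLinearMapAsModule ρ σ f
  have hF : LinearMap.ker F = Module.jacobson k[G] ρ.asModule :=
    congrArg Subrepresentation.subrepresentationSubmoduleOrderIso hker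
  rw [isSemisimpleRepresentation_iff_isSemisimpleModule_asModule,
    IsArtinian.isSemisimpleModule_iff_jacobson, ← Module.map_jacobson_of_ker_le (f := F) hf hF.le,
    ← hF, ← LinearMap.le_ker_iff_map]

/-- The translate `g⁻¹ N` of a subrepresentation `N` of the restriction to a normal subgroup, as the
preimage of `N` under the action of `g`. -/
def comapSubrepresentation {H : Subgroup G} [H.Normal] (N : Subrepresentation (res ρ H)) (g : G) :
    Subrepresentation (res ρ H) where
  toSubmodule := N.toSubmodule.comap (ρ g)
  apply_mem_toSubmodule x v hv := by
    have hconj : ρ g (ρ x v) = ρ (MulAut.conjNormal g x : H) (ρ g v) := by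
      simp only [← Module.End.mul_apply, ← map_mul, MulAut.conjNormal_apply, inv_mul_cancel_right]
    exact (congrArg (· ∈ N) hconj).mpr (N.apply_mem_toSubmodule (MulAut.conjNormal g x) hv)

/-- The automorphism `N ↦ g⁻¹ N` of the lattice of subrepresentations of the restriction to a normal
subgroup. -/
def comapOrderIso (ρ : Representation k G V) (H : Subgroup G) [H.Normal] (g : G) :
    Subrepresentation (res ρ H) ≃o Subrepresentation (res ρ H) where
  toFun N := comapSubrepresentation N g
  invFun N := comapSubrepresentation N g⁻¹
  left_inv N := SetLike.ext fun v => by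
    change ρ g (ρ g⁻¹ v) ∈ N ↔ v ∈ N
    rw [self_inv_apply]
  right_inv N := SetLike.ext fun v => by
    change ρ g⁻¹ (ρ g v) ∈ N ↔ v ∈ N
    rw [inv_self_apply]
  map_rel_iff' {N N'} := by
    refine ⟨fun hle v hv => ?_, fun hle v hv => hle hv⟩
    have hv' : ρ g (ρ g⁻¹ v) ∈ N' := hle (show ρ g (ρ g⁻¹ v) ∈ N by rwa [self_inv_apply])
    rwa [self_inv_apply] at hv'

lemma apply_mem_radical_res {H : Subgroup G} [H.Normal] (g : G) {v : V}
    (hv : v ∈ radical (res ρ H)) : ρ g v ∈ radical (res ρ H) :=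
  mem_radical.2 fun N hN =>
    mem_radical.1 hv _ (((comapOrderIso ρ H g).isCoatom_iff N).2 hN)

lemma map_relTrace_of_forall_eq [Finite G] {K H : Subgroup G} (L : V →ₗ[k] W) {m : fixed ρ K}
    {w : W} (hL : ∀ x ∈ H, L (ρ x m) = w) : L (relTrace ρ K H m) = K.relIndex H • w := by
  have := Fintype.ofFinite (H ⧸ K.subgroupOf H)
  calc L (relTrace ρ K H m)
      = L (∑ q : H ⧸ K.subgroupOf H, ρ (q.out : H) (m : V)) :=
        congrArg L (finsum_eq_sum_of_fintype _)
    _ = ∑ _q : H ⧸ K.subgroupOf H, w := by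
        rw [map_sum, Finset.sum_congr rfl fun q _ => hL _ q.out.2]
    _ = K.relIndex H • w := by
        rw [Finset.sum_const, Finset.card_univ, ← Nat.card_eq_fintype_card]; rfl

/-- The averaged relative trace `[G : H]⁻¹ tr_H^G : M^H → M^G`; it is zero if the index vanishes
in `k`. -/
def average [Finite G] (ρ : Representation k G V) (H : Subgroup G) : fixed ρ H →ₗ[k] fixed ρ ⊤ :=
  (H.index : k)⁻¹ • relTrace ρ H ⊤

lemma map_average_of_forall_eq [Finite G] {H : Subgroup G} (hH : (H.index : k) ≠ 0)
    (L : V →ₗ[k] W) {m : fixed ρ H} {w : W} (hL : ∀ x, L (ρ x m) = w) : L (average ρ H m) = w :=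
  calc L (average ρ H m) = (H.index : k)⁻¹ • L (relTrace ρ H ⊤ m) := map_smul L _ _
    _ = (H.index : k)⁻¹ • (H.index : k) • w := by
        rw [map_relTrace_of_forall_eq L fun x _ => hL x, Subgroup.relIndex_top_right,
          Nat.cast_smul_eq_nsmul]
    _ = w := inv_smul_smul₀ hH w

/-- A subrepresentation regarded as a subrepresentation of the restriction to a subgroup. -/
def resSubrepresentation (N : Subrepresentation ρ) (H : Subgroup G) :
    Subrepresentation (res ρ H) :=
  ⟨N.toSubmodule, fun x _ hv => N.apply_mem_toSubmodule x hv⟩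

/-- Relative Maschke theorem: a projection that commutes with `H` is averaged over `G / H`. -/
lemma isSemisimpleRepresentation_of_res [Finite G] {H : Subgroup G}
    [IsSemisimpleRepresentation (res ρ H)] (hH : (H.index : k) ≠ 0) :
    IsSemisimpleRepresentation ρ := by
  refine ⟨fun N => ?_⟩
  obtain ⟨C, hC⟩ := exists_isCompl (resSubrepresentation N H)
  let f : (res ρ H).IntertwiningMap (res ρ H) := (inclusion _).comp (projection hC)
  have hfN (v : V) : f v ∈ N := (projection hC v).2
  have hf_id {v : V} (hv : v ∈ N) : f v = v :=
    congrArg Subtype.val (projection_apply_coe hC ⟨v, hv⟩)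
  have hf : f.toLinearMap ∈ fixed (linHom ρ ρ) H := fun x => LinearMap.ext fun v => by
    change ρ x (f (ρ (x : G)⁻¹ v)) = f v
    have hx : f (ρ x (ρ (x : G)⁻¹ v)) = ρ x (f (ρ (x : G)⁻¹ v)) :=
      IntertwiningMap.isIntertwining (res ρ H) (res ρ H) f x _
    rw [← hx, self_inv_apply]
  let E : fixed (linHom ρ ρ) ⊤ := average (linHom ρ ρ) H ⟨_, hf⟩
  have hproj : LinearMap.IsProj N.toSubmodule E.1 := by
    constructor
    · intro v
      refine (Submodule.Quotient.mk_eq_zero _).1 <|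
        map_average_of_forall_eq hH (N.toSubmodule.mkQ ∘ₗ LinearMap.applyₗ v) fun x => ?_
      exact (Submodule.Quotient.mk_eq_zero _).2 (N.apply_mem_toSubmodule x (hfN _))
    · intro v hv
      refine map_average_of_forall_eq hH (LinearMap.applyₗ v) fun x => ?_
      change ρ x (f (ρ x⁻¹ v)) = v
      rw [hf_id (N.apply_mem_toSubmodule x⁻¹ hv), self_inv_apply]
  let F : ρ.IntertwiningMap ρ := ⟨E.1, fun g => LinearMap.ext fun v => by
    have hinv : ρ g (E.1 (ρ g⁻¹ (ρ g v))) = E.1 (ρ g v) :=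
      LinearMap.congr_fun (E.2 ⟨g, trivial⟩) (ρ g v)
    rw [inv_self_apply] at hinv
    exact hinv.symm⟩
  exact ⟨F.ker, isCompl_toSubmodule.1 hproj.isCompl⟩

lemma radical_le_radical_res [Finite G] [FiniteDimensional k V] {H : Subgroup G} [H.Normal]
    (hH : (H.index : k) ≠ 0) : resSubrepresentation (radical ρ) H ≤ radical (res ρ H) := by
  let R := (radical (res ρ H)).toSubmodule
  let σ := ρ.quotient R fun g _ hv => apply_mem_radical_res g hv
  let q : ρ.IntertwiningMap σ := ⟨R.mkQ, fun _ => rfl⟩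
  let qH : (res ρ H).IntertwiningMap (res σ H) := ⟨R.mkQ, fun _ => rfl⟩
  have hker : qH.ker = radical (res ρ H) :=
    Subrepresentation.toSubmodule_injective (Submodule.ker_mkQ R)
  have : IsSemisimpleRepresentation (res σ H) :=
    isSemisimpleRepresentation_of_ker_eq_radical qH (Submodule.mkQ_surjective R) hker
  have : IsSemisimpleRepresentation σ := isSemisimpleRepresentation_of_res hH
  intro v hv
  have hqv : q v ∈ radical σ := apply_mem_radical q hv
  rw [radical_eq_bot] at hqv
  exact (Submodule.Quotient.mk_eq_zero R).1 hqv

lemma isGreatest_resSubrepresentation [Finite G] [FiniteDimensional k V] {H : Subgroup G}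
    [H.Normal] (hH : (H.index : k) ≠ 0) {K : Subrepresentation ρ}
    (hK : IsGreatest {N : Subrepresentation ρ | N ≠ ⊤} K)
    (hcoatom : IsCoatom (resSubrepresentation K H)) :
    IsGreatest {N : Subrepresentation (res ρ H) | N ≠ ⊤} (resSubrepresentation K H) :=
  isGreatest_of_isCoatom_of_le_radical hcoatom fun _ hv =>
    radical_le_radical_res hH (le_radical_of_isGreatest hK hv)

lemma IsScottModule.isIndecomposable_res [Finite G] {P : Subgroup G} [P.Normal]
    (hρ : IsScottModule ρ P) {H : Subgroup G} [H.Normal] (hH : (H.index : k) ≠ 0) :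
    IsIndecomposable (res ρ H) := by
  have := hρ.isDirectSummand.finiteDimensional
  obtain ⟨π, hπ⟩ := hρ.trivialInTop.exists_intertwiningMap
  have hcoatom : IsCoatom (resSubrepresentation π.ker H) :=
    isCoatom_of_isCoatom_toSubmodule (isCoatom_ker_toSubmodule hπ)
  exact isIndecomposable_of_isGreatest <| isGreatest_resSubrepresentation hH
    (hρ.isIndecomposable.isGreatest_ker hρ.isDirectSummand hπ) hcoatom

lemma traceSum_eq_bot {p : ℕ} [Fact p.Prime] [CharP k p] [Finite G] {Q : Subgroup G}
    (hQ : IsPGroup p Q) (htriv : ∀ x ∈ Q, ∀ v, ρ x v = v) : traceSum ρ Q = ⊥ := by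
  refine le_bot_iff.1 (iSup₂_le fun K hK => ?_)
  rintro _ ⟨m, rfl⟩
  obtain ⟨n, hn⟩ := hQ.index (K.subgroupOf Q)
  have hn0 : n ≠ 0 := by
    rintro rfl
    rw [pow_zero, Subgroup.index_eq_one, Subgroup.subgroupOf_eq_top] at hn
    exact hK.not_ge hn
  have hindex : (K.relIndex Q : k) = 0 := by
    rw [Subgroup.relIndex, hn, Nat.cast_pow, CharP.cast_eq_zero, zero_pow hn0]
  refine Subtype.ext ?_
  calc (relTrace ρ K Q m : V)
      = K.relIndex Q • (m : V) :=
        map_relTrace_of_forall_eq LinearMap.id fun x hx => htriv x hx m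
    _ = 0 := by rw [← Nat.cast_smul_eq_nsmul k, hindex, zero_smul]

/-- The isomorphism `M ≃ M(Q)` for a `p`-group `Q` that acts trivially on `M`. -/
def brauerEquiv {p : ℕ} [Fact p.Prime] [CharP k p] [Finite G] {Q : Subgroup G}
    (hQ : IsPGroup p Q) (htriv : ∀ x ∈ Q, ∀ v, ρ x v = v) :
    V ≃ₗ[k] fixed ρ Q ⧸ traceSum ρ Q :=
  (LinearEquiv.ofTop (fixed ρ Q) (top_le_iff.1 fun v _ x => htriv x x.2 v)).symm ≪≫ₗ
    ((traceSum ρ Q).quotEquivOfEqBot (traceSum_eq_bot hQ htriv)).symm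

lemma brauerEquiv_apply {p : ℕ} [Fact p.Prime] [CharP k p] [Finite G] {Q : Subgroup G}
    (hQ : IsPGroup p Q) (htriv : ∀ x ∈ Q, ∀ v, ρ x v = v)
    (n : Subgroup.normalizer (Q : Set G)) (v : V) :
    brauerEquiv hQ htriv (ρ n v) = brauer ρ Q n (brauerEquiv hQ htriv v) :=
  rfl

lemma IsIndecomposable.of_linearEquiv {H : Type*} [Group H] {τ : Representation k H W}
    (h : IsIndecomposable ρ) (φ : V ≃ₗ[k] W) (hφ : ∀ x, ∃ y, ∀ v, φ (ρ x v) = τ y (φ v)) :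
    IsIndecomposable τ := by
  have := h.1
  refine ⟨φ.symm.toEquiv.nontrivial, fun W₁ W₂ hW => ?_⟩
  let e : Submodule k W ≃o Submodule k V := Submodule.orderIsoMapComap φ.symm
  let T (N : Subrepresentation τ) : Subrepresentation ρ :=
    ⟨N.toSubmodule.comap φ.toLinearMap, fun x v hv => by
      obtain ⟨y, hy⟩ := hφ x
      change φ (ρ x v) ∈ N.toSubmodule
      rw [hy]
      exact N.apply_mem_toSubmodule y hv⟩
  have hcomap : ∀ N, (T N).toSubmodule = e N.toSubmodule := fun N =>
    Submodule.comap_equiv_eq_map_symm φ N.toSubmodule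
  have hbot : ∀ N, T N = ⊥ → N = ⊥ := by
    intro N hN
    refine Subrepresentation.toSubmodule_injective ((map_eq_bot_iff e).1 ?_)
    rw [← hcomap, hN]
    rfl
  have hT : IsCompl (T W₁) (T W₂) := by
    rw [← isCompl_toSubmodule, hcomap, hcomap]
    exact e.isCompl_iff.1 (isCompl_toSubmodule.2 hW)
  exact (h.2 _ _ hT).imp (hbot _) (hbot _)

end ScottBrauer

end

open ScottBrauer in
theorem corollary2p2_general {p : ℕ} [Fact p.Prime] {k : Type*} [Field k] [CharP k p]
    {G : Type*} [Group G] [Finite G] {P : Subgroup G} (hP : IsPGroup p P) [P.Normal]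
    (hp : ¬ p ∣ (P ⊔ Subgroup.centralizer (P : Set G)).index)
    {V : Type*} [AddCommGroup V] [Module k V] {M : Representation k G V}
    (hM : IsScottModule M P) {Q : Subgroup G} (hQP : Q ≤ P) :
    IsIndecomposable
      ((brauer M Q).comp (Subgroup.inclusion (mul_centralizer_le_normalizer Q))) := by
  have htriv {x : G} (hx : x ∈ P) (v : V) : M x v = v := hM.isDirectSummand.apply_eq_self hx v
  have hindex : ((P ⊔ Subgroup.centralizer (P : Set G)).index : k) ≠ 0 :=
    fun h => hp ((CharP.cast_eq_zero_iff k p _).1 h)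
  refine (hM.isIndecomposable_res hindex).of_linearEquiv
    (brauerEquiv (hP.to_le hQP) fun x hx => htriv (hQP hx)) ?_
  rintro ⟨x, hx⟩
  obtain ⟨a, ha, c, hc, rfl⟩ := Subgroup.mem_sup_of_normal_left.1 hx
  have hcQ : c ∈ Subgroup.centralizer (Q : Set G) := Subgroup.centralizer_le hQP hc
  refine ⟨⟨c, Subgroup.mem_sup_right hcQ⟩, fun v => ?_⟩
  have hac : M (a * c) v = M c v := by rw [map_mul, Module.End.mul_apply, htriv ha]
  exact (congrArg _ hac).trans
    (brauerEquiv_apply _ _ ⟨c, mul_centralizer_le_normalizer Q (Subgroup.mem_sup_right hcQ)⟩ v)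

theorem corollary2p2 {p : ℕ} [Fact p.Prime] {k : Type*} [Field k] [IsAlgClosed k] [CharP k p]
    {G : Type*} [Group G] [Finite G] (P : Subgroup G) (hP : IsPGroup p P) (hPn : P.Normal)
    (hp : ¬ p ∣ (P ⊔ Subgroup.centralizer (P : Set G)).index)
    {V : Type*} [AddCommGroup V] [Module k V] (M : Representation k G V)
    (hM : ScottBrauer.IsScottModule M P) :
    ScottBrauer.IsBrauerIndecomposable M P :=
  fun _ hQP => Or.inl (corollary2p2_general hP hp hM hQP)
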